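/- **Theorem (Silver).** Work in ZFC. Definitions. For a set $A$, a collection $S$ of subsets of $A$ is *stationary* if for every function $F : [A]^{<\omega} \to A$ there is $X \in S$ closed under $F$. An infinite cardinal $\kappa$ is *Jónsson* if every structure with universe $\kappa$ in a countable first-order language has an elementary substructure of cardinality $\kappa$ that is different from the whole structure. $H_{\aleph_\omega}$ is the set of all sets whose transitive closure has cardinality less than $\aleph_\omega$, viewed as a structure for the language $\{\in\}$. For $M \prec H_{\aleph_\omega}$ with $|M \cap \aleph_\omega| = \aleph_\omega$, let $\chi_M : \omega \to \omega$ be the function for which $\chi_M(n)$ is the unique $m \ge n$ such that $M \cap \aleph_m$ has order type $\aleph_n$. For $f : \omega \to \omega$, the cardinal $\aleph_\omega$ is *$f$-Jónsson* if the collection $\{ M \prec H_{\aleph_\omega} : |M| = \aleph_\omega,\ |M\cap\aleph_\omega| = \aleph_\omega \text{ and } \chi_M = f \}$ is stationary. For sequences of cardinals $\langle \lambda_i \rangle_{i<\omega}$ and $\langle \kappa_i \rangle_{i<\omega}$ with $\lambda = \sup_{i<\omega} \lambda_i$, the notation $\langle \lambda_i \rangle_{i<\omega} \twoheadrightarrow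 \langle \kappa_i \rangle_{i<\omega}$ means that for every $F : [\lambda]^{<\omega} \to \lambda$ there is $X \subseteq \lambda$ closed under $F$ such that $|X \cap \lambda_i| = \kappa_i$ for all $i<\omega$. "Increasing" means strictly increasing. Statement. Suppose that $\aleph_\omega$ is Jónsson and $2^{\aleph_0} < \aleph_\omega$. Then $\aleph_\omega$ is $f$-Jónsson for some increasing $f : \omega \to \omega$ with $f \ne \mathrm{id}$. Consequently, there is an increasing sequence $\langle n_i \rangle_{i<\omega}$ of natural numbers such that $\langle \aleph_{n_{i+1}} \rangle_{i<\omega} \twoheadrightarrow \langle \aleph_{n_i} \rangle_{i<\omega}$. -/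

import Mathlib

open scoped Cardinal Ordinal

universe u

namespace Silver

/-! ### Stationary sets, Jónsson cardinals and Chang's Conjecture -/

/-- `X` is closed under the function `F : [α]^{<ω} → α`. -/
def ClosedUnder {α : Type*} (F : Finset α → α) (X : Set α) : Prop :=
  ∀ s : Finset α, (s : Set α) ⊆ X → F s ∈ X

/-- A collection `S` of subsets of `α` is stationary if every function `F : [α]^{<ω} → α`
admits some `X ∈ S` closed under it. -/
def Stationary {α : Type*} (S : Set (Set α)) : Prop :=
  ∀ F : Finset α → α, ∃ X ∈ S, ClosedUnder F X

/-- The underlying set of the cardinal `κ`: all ordinals below (the initial ordinal) `κ`. -/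
abbrev Below (κ : Cardinal.{u}) : Set Ordinal.{u} := Set.Iio κ.ord

/-- An infinite cardinal `κ` is Jónsson if every structure on `κ` in a countable first-order
language has a proper elementary substructure of size `κ`. -/
def IsJonsson (κ : Cardinal.{u}) : Prop :=
  ℵ₀ ≤ κ ∧
    ∀ (L : FirstOrder.Language.{0, 0}) [Countable L.Symbols] [L.Structure (Below κ)],
      ∃ B : L.ElementarySubstructure (Below κ),
        #(B : Set (Below κ)) = Cardinal.lift.{u + 1} κ ∧ (B : Set (Below κ)) ≠ Set.univ

/-- The generalized Chang's Conjecture `⟨lam i⟩ ↠ ⟨kap i⟩`: with `lam = sup lam i`, for every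
`F : [lam]^{<ω} → lam` there is `X ⊆ lam` closed under `F` with `|X ∩ lam i| = kap i` for all `i`.
(A family indexed by `I : Type` is bounded, so that the supremum is the true one.) -/
def Chang {I : Type} (lam kap : I → Cardinal.{u}) : Prop :=
  ∀ F : Finset (Below (⨆ i, lam i)) → Below (⨆ i, lam i),
    ∃ X : Set (Below (⨆ i, lam i)), ClosedUnder F X ∧
      ∀ i, #{α : Below (⨆ i, lam i) | α ∈ X ∧ α.1 < (lam i).ord} =
        Cardinal.lift.{u + 1} (kap i)

/-! ### The structure `(H_θ, ∈)` -/

/-- The set of elements of the transitive closure of `x`. -/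
def trcl (x : ZFSet.{u}) : Set ZFSet.{u} :=
  {z | Relation.TransGen (fun a b : ZFSet.{u} => a ∈ b) z x}

/-- `H_θ`: the sets whose transitive closure has cardinality less than `θ`. -/
def H (θ : Cardinal.{u}) : Set ZFSet.{u} :=
  {x | #(trcl x) < Cardinal.lift.{u + 1} θ}

/-- The only non-logical symbol of the language of set theory: a binary relation symbol. -/
inductive SetRel : ℕ → Type
  | mem : SetRel 2

/-- The first-order language `{∈}` of set theory. -/
def setLang : FirstOrder.Language.{0, 0} where
  Functions := fun _ => Empty
  Relations := SetRel

/-- `H_θ` as a structure, with `∈` interpreted as membership. -/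
instance structureH {θ : Cardinal.{u}} : setLang.Structure (H θ) where
  funMap := fun f => f.elim
  RelMap := fun {_} r =>
    match r with
    | SetRel.mem => fun v => (v 0 : ZFSet.{u}) ∈ (v 1 : ZFSet.{u})

/-- `M ≺ H_θ`. -/
def IsElementary {θ : Cardinal.{u}} (M : Set (H θ)) : Prop :=
  ∃ S : setLang.ElementarySubstructure (H θ), (S : Set (H θ)) = M

/-! ### The characteristic function and `f`-Jónssonness -/

/-- `M ∩ κ`: the ordinals below `κ` whose von Neumann representatives belong to `M`. -/
def inter {θ : Cardinal.{u}} (M : Set (H θ)) (κ : Cardinal.{u}) : Set Ordinal.{u} :=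
  {α | α < κ.ord ∧ ∃ x ∈ M, (x : ZFSet.{u}) = α.toZFSet}

/-- `χ_M` is defined and equal to `f`: `|M ∩ ℵ_ω| = ℵ_ω`, and for every `n`, `f n` is the
unique `m ≥ n` such that `M ∩ ℵ_m` has order type `ℵ_n`. -/
def ChiEq {θ : Cardinal.{u}} (M : Set (H θ)) (f : ℕ → ℕ) : Prop :=
  #(inter M (ℵ_ ω)) = ℵ_ ω ∧
    ∀ n m : ℕ, (n ≤ m ∧ typeLT (inter M (ℵ_ m)) = (ℵ_ n).ord) ↔ m = f n

/-- `ℵ_ω` is `f`-Jónsson: the collection of all `M ≺ H_{ℵ_ω}` with `|M| = ℵ_ω` and `χ_M = f` is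
stationary. -/
def FJonsson (f : ℕ → ℕ) : Prop :=
  Stationary {M : Set (H (ℵ_ ω : Cardinal.{u})) | IsElementary M ∧ #M = ℵ_ ω ∧ ChiEq M f}

end Silver

/-!
# Silver's theorem on Jónsson cardinals and Chang's Conjecture at `ℵ_ω`

Suppose that for every increasing `f ≠ id` some function `F_f` on `H_{ℵ_ω}` shows that `ℵ_ω` is not
`f`-Jónsson. It suffices to find `M ≺ H_{ℵ_ω}` closed under all the functions `F_f` at once, with
`|M| = |M ∩ ℵ_ω| = ℵ_ω` and `ℵ_ω ⊄ M`: then `χ_M` is defined, increasing and different from `id`, and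
closure under `F_f` for `f = χ_M` is a contradiction. There are `2^ℵ₀ ≤ ℵ_k` functions `f`, so if they
are coded by ordinals below `ω_k`, then closure under all `F_f` amounts to closure under one function
together with `ω_k ⊆ M`.

Everything is moved to `ω_ω` itself. A set `K ⊆ H_{ℵ_ω}` of size `ℵ_ω`, closed under the functions `F_f`
and under Skolem functions and containing the ordinals (`exists_hull`), is put in bijection with
`ω_ω`; elementarity and closure then become closure under countably many operations on `ω_ω`.

* Jónssonness gives a proper set `M ⊆ ω_ω` of full size closed under any countably many operations
  (`IsJonsson.exists_opClosed`).
* If the operations include injections of each `α < ω_{m+1}` into `ω_m` and their inverses, then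
  `|M ∩ ω_{m+1}| ≤ |M ∩ ω_m|⁺`. Hence every `ℵ_n` occurs as a value, and the first time it does, the order
  type is `ω_n`; this is the characteristic function (`OpClosed.exists_chi`). Moreover, if
  `|M ∩ ω_m| = ℵ_m` for all large `m`, then `M = ω_ω` (`OpClosed.eq_below`). So, `M` being proper,
  `M ∩ ω_m` is bounded in `ω_m` for some `m > k`.
* The hull of `M ∪ ω_k` is still proper. If `M` is also closed under the operations that send `a` to the
  supremum of the values `t(a, β) < ω_m` with `β` ranging over tuples from `ω_k`, for terms `t`, then,
  `ω_m` being regular, every element of the hull below `ω_m` is bounded by an element of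
  `M ∩ ω_m` (`exists_le_of_mem_closure`, `IsJonsson.exists_opClosed_Iio_subset`).

For Chang's Conjecture take `n_{i+1} = f(n_i)`, starting from some `n_0` with `f(n_0) > n_0`; the trace on
`ω_ω` of a submodel `M` with `χ_M = f` has exactly `ℵ_{n_i}` elements below `ω_{n_{i+1}}`.
-/

namespace Silver
open Set

/-! ### Sets of ordinals closed under operations -/

/-- A set `N` of ordinals is closed under a family `G` of finitary operations, each regarded as a
partial operation on `ω_ω`: values that are not below `ω_ω` are disregarded. -/
def OpClosed (G : Set (List Ordinal.{u} → Ordinal.{u})) (N : Set Ordinal.{u}) : Prop :=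
  ∀ g ∈ G, ∀ l : List Ordinal.{u}, (∀ x ∈ l, x ∈ N) → g l < (ℵ_ ω).ord → g l ∈ N

theorem OpClosed.mono {G G' : Set (List Ordinal.{u} → Ordinal.{u})} {N : Set Ordinal.{u}}
    (h : OpClosed G' N) (hG : G ⊆ G') : OpClosed G N :=
  fun g hg => h g (hG hg)

/-- The language with countably many function symbols of each arity. -/
def opLang : FirstOrder.Language.{0, 0} where
  Functions := fun _ => ℕ
  Relations := fun _ => Empty

instance : Countable opLang.Symbols :=
  inferInstanceAs (Countable ((Σ _ : ℕ, ℕ) ⊕ (Σ _ : ℕ, Empty)))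

theorem zero_lt_ord_aleph (o : Ordinal.{u}) : 0 < (ℵ_ o).ord :=
  Cardinal.ord_pos.2 (Cardinal.aleph_pos o)

/-- The structure on `ω_ω` whose functions are given by a sequence of operations on lists;
a value that is not below `ω_ω` is replaced by `0`. -/
@[reducible] noncomputable def opStructure (g : ℕ → List Ordinal.{u} → Ordinal.{u}) :
    opLang.Structure (Below (ℵ_ ω : Cardinal.{u})) where
  funMap := fun {_} i v =>
    if h : g i (List.ofFn fun j => (v j : Ordinal.{u})) < (ℵ_ ω).ord then ⟨_, h⟩
    else ⟨0, zero_lt_ord_aleph _⟩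
  RelMap := fun r => r.elim

theorem opClosed_of_substructure (g : ℕ → List Ordinal.{u} → Ordinal.{u})
    (S : letI := opStructure g; opLang.Substructure (Below (ℵ_ ω : Cardinal.{u}))) :
    letI := opStructure g
    OpClosed (range g) (Subtype.val '' (S : Set (Below (ℵ_ ω : Cardinal.{u})))) := by
  let := opStructure g
  have : Nonempty (Below (ℵ_ ω : Cardinal.{u})) := ⟨⟨0, zero_lt_ord_aleph _⟩⟩
  rintro _ ⟨i, rfl⟩ l hl hlt
  choose! w hw using hl
  have h := S.fun_mem (n := l.length) i (fun j => w (l.get j)) (fun j => (hw _ (l.get_mem j)).1)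
  have hval : List.ofFn (fun j : Fin l.length => ((w (l.get j) : Below _) : Ordinal.{u})) = l := by
    conv_rhs => rw [← List.ofFn_get l]
    congr 1
    funext j
    exact (hw _ (l.get_mem j)).2
  refine ⟨_, h, ?_⟩
  change ((if h : g i (List.ofFn (fun j : Fin l.length => ((w (l.get j) : Below _) : Ordinal.{u})))
    < (ℵ_ ω).ord then (⟨_, h⟩ : Below _) else ⟨0, zero_lt_ord_aleph _⟩ : Below _) :
    Ordinal.{u}) = g i l
  rw [hval, dif_pos hlt]

/-- A Jónsson cardinal carries no Jónsson algebra: countably many operations on `ω_ω` have a common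
proper closed set of full size. -/
theorem IsJonsson.exists_opClosed (hJ : IsJonsson (ℵ_ ω : Cardinal.{u}))
    {G : Set (List Ordinal.{u} → Ordinal.{u})} (hG : G.Countable) (hne : G.Nonempty) :
    ∃ M ⊆ Below (ℵ_ ω : Cardinal.{u}), OpClosed G M ∧ #M = ℵ_ ω ∧ M ≠ Below (ℵ_ ω) := by
  obtain ⟨g, rfl⟩ := hG.exists_eq_range hne
  let := opStructure g
  obtain ⟨B, hB, hne⟩ := hJ.2 opLang
  refine ⟨Subtype.val '' (B : Set (Below (ℵ_ ω : Cardinal.{u}))), ?_, ?_, ?_, ?_⟩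
  · rintro _ ⟨x, -, rfl⟩
    exact x.2
  · exact opClosed_of_substructure g B.toSubstructure
  · rw [Cardinal.mk_image_eq Subtype.val_injective, hB]
    simp
  · intro h
    apply hne
    rw [eq_univ_iff_forall]
    intro x
    obtain ⟨y, hy, hxy⟩ := h.symm.subset x.2
    rwa [← Subtype.ext hxy]

/-! ### Collapsing operations and the characteristic function -/

theorem exists_collapse (α : Ordinal.{u}) : ∃ c : Ordinal.{u} → Ordinal.{u},
    MapsTo c (Iio α) (Iio α.card.ord) ∧ InjOn c (Iio α) := by
  have h : #(Iio α) = #(Iio α.card.ord) := by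
    simp [Cardinal.mk_Iio_ordinal]
  obtain ⟨e⟩ := Cardinal.eq.1 h
  refine ⟨fun ξ => if h : ξ < α then (e ⟨ξ, h⟩ : Ordinal) else 0, fun ξ hξ => ?_,
    fun ξ hξ ζ hζ hh => ?_⟩
  · simp only [mem_Iio] at hξ
    simp only [hξ, dite_true]
    exact (e ⟨ξ, hξ⟩).2
  · simp only [mem_Iio] at hξ hζ
    simp only [hξ, hζ, dite_true] at hh
    exact congrArg Subtype.val (e.injective (Subtype.ext hh))

/-- A chosen injection of the ordinal `α` into its cardinality. -/
noncomputable def collapse (α : Ordinal.{u}) : Ordinal.{u} → Ordinal.{u} :=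
  (exists_collapse α).choose

theorem mapsTo_collapse (α : Ordinal.{u}) : MapsTo (collapse α) (Iio α) (Iio α.card.ord) :=
  (exists_collapse α).choose_spec.1

theorem injOn_collapse (α : Ordinal.{u}) : InjOn (collapse α) (Iio α) :=
  (exists_collapse α).choose_spec.2

/-- The inverse of `collapse α`, a partial surjection of the cardinality of `α` onto `α`. -/
noncomputable def uncollapse (α : Ordinal.{u}) : Ordinal.{u} → Ordinal.{u} :=
  Function.invFunOn (collapse α) (Iio α)

theorem uncollapse_collapse {α ξ : Ordinal.{u}} (h : ξ < α) : uncollapse α (collapse α ξ) = ξ :=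
  (injOn_collapse α).leftInvOn_invFunOn h

/-- The operations under which a set of ordinals must be closed for its characteristic function to
be defined: the finite ordinals and the `ω_n` as constants, and the collapsing maps. -/
def baseOps : Set (List Ordinal.{u} → Ordinal.{u}) :=
  range (fun (n : ℕ) _ => (n : Ordinal.{u})) ∪ range (fun (n : ℕ) _ => (ℵ_ (n : Ordinal.{u})).ord) ∪
    {fun l => collapse (l.getD 0 0) (l.getD 1 0), fun l => uncollapse (l.getD 0 0) (l.getD 1 0)}

theorem countable_baseOps : baseOps.{u}.Countable :=
  ((countable_range _).union (countable_range _)).union (by simp)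

theorem aleph_nat_lt_aleph_omega (n : ℕ) : ℵ_ (n : Ordinal.{u}) < ℵ_ ω :=
  Cardinal.aleph_lt_aleph.2 (Ordinal.natCast_lt_omega0 n)

theorem exists_lt_aleph_nat {c : Cardinal.{u}} (h : c < ℵ_ ω) : ∃ m : ℕ, c < ℵ_ m := by
  rw [Cardinal.aleph_limit Ordinal.isSuccLimit_omega0] at h
  obtain ⟨⟨a, ha⟩, hc⟩ := exists_lt_of_lt_ciSup' h
  obtain ⟨n, rfl⟩ := Ordinal.lt_omega0.1 ha
  exact ⟨n, hc⟩

theorem exists_lt_ord_aleph_nat {x : Ordinal.{u}} (h : x < (ℵ_ ω).ord) :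
    ∃ m : ℕ, x < (ℵ_ (m : Ordinal.{u})).ord := by
  simp only [Cardinal.lt_ord] at h ⊢
  exact exists_lt_aleph_nat h

section

variable {N : Set Ordinal.{u}}

theorem OpClosed.natCast_mem (h : OpClosed baseOps N) (n : ℕ) : (n : Ordinal.{u}) ∈ N :=
  h (fun _ => (n : Ordinal.{u})) (Or.inl (Or.inl ⟨n, rfl⟩)) [] (by simp) <| by
    rw [Cardinal.lt_ord]
    simpa using (Cardinal.natCast_lt_aleph0 (n := n)).trans_le (Cardinal.aleph0_le_aleph _)

theorem OpClosed.ord_aleph_mem (h : OpClosed baseOps N) (n : ℕ) :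
    (ℵ_ (n : Ordinal.{u})).ord ∈ N :=
  h (fun _ => (ℵ_ (n : Ordinal.{u})).ord) (Or.inl (Or.inr ⟨n, rfl⟩)) [] (by simp)
    (Cardinal.ord_lt_ord.2 (aleph_nat_lt_aleph_omega n))

theorem OpClosed.collapse_mem (h : OpClosed baseOps N) {α ξ : Ordinal.{u}} (hα : α ∈ N)
    (hξ : ξ ∈ N) (hlt : collapse α ξ < (ℵ_ ω).ord) : collapse α ξ ∈ N :=
  h (fun l => collapse (l.getD 0 0) (l.getD 1 0)) (Or.inr (Or.inl rfl)) [α, ξ]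
    (by simp [hα, hξ]) hlt

theorem OpClosed.uncollapse_mem (h : OpClosed baseOps N) {α ξ : Ordinal.{u}} (hα : α ∈ N)
    (hξ : ξ ∈ N) (hlt : uncollapse α ξ < (ℵ_ ω).ord) : uncollapse α ξ ∈ N :=
  h (fun l => uncollapse (l.getD 0 0) (l.getD 1 0)) (Or.inr (Or.inr rfl)) [α, ξ]
    (by simp [hα, hξ]) hlt

theorem aleph_natCast_add_one (m : ℕ) :
    ℵ_ ((m + 1 : ℕ) : Ordinal.{u}) = Order.succ (ℵ_ (m : Ordinal.{u})) := by
  simp [Cardinal.succ_aleph]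

/-- The initial segments of `N ∩ ω_{m+1}` have size at most `|N ∩ ω_m|`, because `N` is closed
under the collapsing maps. -/
theorem OpClosed.mk_inter_Iio_le (h : OpClosed baseOps N) {m : ℕ} {α : Ordinal.{u}} (hα : α ∈ N)
    (hαm : α < (ℵ_ ((m + 1 : ℕ) : Ordinal.{u})).ord) :
    #(N ∩ Iio α : Set Ordinal.{u}) ≤ #(N ∩ Iio (ℵ_ (m : Ordinal.{u})).ord : Set Ordinal.{u}) := by
  have hle : α.card.ord ≤ (ℵ_ (m : Ordinal.{u})).ord := by
    rw [Cardinal.lt_ord, aleph_natCast_add_one, Order.lt_succ_iff] at hαm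
    exact Cardinal.ord_le_ord.2 hαm
  refine Cardinal.mk_le_of_injective (f := fun ξ : (N ∩ Iio α : Set Ordinal.{u}) =>
    (⟨collapse α ξ, ?_⟩ : (N ∩ Iio (ℵ_ (m : Ordinal.{u})).ord : Set Ordinal.{u}))) ?_
  · have hlt := (mapsTo_collapse α ξ.2.2).trans_le hle
    exact ⟨h.collapse_mem hα ξ.2.1
      (hlt.trans (Cardinal.ord_lt_ord.2 (aleph_nat_lt_aleph_omega m))), hlt⟩
  · intro ξ ζ hξζ
    exact Subtype.ext (injOn_collapse α ξ.2.2 ζ.2.2 (congrArg Subtype.val hξζ))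

theorem card_typein_set (S : Set Ordinal.{u}) (a : S) :
    (Ordinal.typein (α := S) (· < ·) a).card = #(S ∩ Iio (a : Ordinal.{u}) : Set Ordinal.{u}) := by
  rw [Ordinal.card_typein]
  refine Cardinal.mk_congr ⟨fun x => ⟨x.1.1, x.1.2, x.2⟩, fun x => ⟨⟨x.1, x.2.1⟩, x.2.2⟩,
    fun _ => rfl, fun _ => rfl⟩

/-- A set of ordinals whose proper initial segments all have size less than `c` has order type at
most the initial ordinal of `c`. -/
theorem typeLT_le_ord (S : Set Ordinal.{u}) (c : Cardinal.{u + 1})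
    (h : ∀ a ∈ S, #(S ∩ Iio a : Set Ordinal.{u}) < c) : typeLT S ≤ c.ord := by
  by_contra! hlt
  obtain ⟨a, ha⟩ := Ordinal.typein_surj (α := S) (· < ·) hlt
  have := h a a.2
  rw [← card_typein_set, ha, Cardinal.card_ord] at this
  exact lt_irrefl _ this

end

section

variable {N : Set Ordinal.{u}}

theorem OpClosed.mk_inter_Iio_lt (h : OpClosed baseOps N) {n m : ℕ}
    (hm : ∀ j < m, #(N ∩ Iio (ℵ_ (j : Ordinal.{u})).ord : Set Ordinal.{u}) < ℵ_ n)
    {α : Ordinal.{u}} (hα : α ∈ N) (hαm : α < (ℵ_ (m : Ordinal.{u})).ord) :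
    #(N ∩ Iio α : Set Ordinal.{u}) < ℵ_ n := by
  rcases m with _ | m
  · refine (Cardinal.mk_le_mk_of_subset inter_subset_right).trans_lt ?_
    rw [Cardinal.mk_Iio_ordinal]
    refine lt_of_lt_of_le ?_ (Cardinal.aleph0_le_aleph _)
    rw [Cardinal.lift_lt_aleph0]
    simpa [Cardinal.lt_ord] using hαm
  · exact (h.mk_inter_Iio_le hα hαm).trans_lt (hm m (Nat.lt_succ_self m))

/-- The sizes of the sets `N ∩ ω_m` skip no cardinal: when these sets first reach size `ℵ_n`, the
order type is exactly `ω_n`. -/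
theorem OpClosed.typeLT_inter_Iio_le (h : OpClosed baseOps N) {n m : ℕ}
    (hm : ∀ j < m, #(N ∩ Iio (ℵ_ (j : Ordinal.{u})).ord : Set Ordinal.{u}) < ℵ_ n) :
    typeLT (N ∩ Iio (ℵ_ (m : Ordinal.{u})).ord : Set Ordinal.{u}) ≤ (ℵ_ n).ord := by
  refine typeLT_le_ord _ _ fun a ha => ?_
  refine (Cardinal.mk_le_mk_of_subset ?_).trans_lt (h.mk_inter_Iio_lt hm ha.1 ha.2)
  exact inter_subset_inter_left _ inter_subset_left

/-- Each `ω_m` belongs to `N`, so `N ∩ ω_m` is a proper initial segment of `N ∩ ω_m'` for `m < m'`.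
This gives the uniqueness of the values of the characteristic function. -/
theorem OpClosed.typeLT_strictMono (h : OpClosed baseOps N) :
    StrictMono fun m : ℕ => typeLT (N ∩ Iio (ℵ_ (m : Ordinal.{u})).ord : Set Ordinal.{u}) := by
  intro m m' hmm
  have hlt : (ℵ_ (m : Ordinal.{u})).ord < (ℵ_ (m' : Ordinal.{u})).ord :=
    Cardinal.ord_lt_ord.2 (Cardinal.aleph_lt_aleph.2 (by exact_mod_cast hmm))
  refine Ordinal.type_lt_iff.2 ⟨⟨⟨⟨inclusion (inter_subset_inter_right _ (Iio_subset_Iio hlt.le)),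
    inclusion_injective _⟩, Iff.rfl⟩, ⟨_, h.ord_aleph_mem m, hlt⟩, fun b => ?_⟩⟩
  constructor
  · rintro ⟨a, rfl⟩
    exact a.2.2
  · intro hb
    exact ⟨⟨b.1, b.2.1, hb⟩, rfl⟩

theorem exists_aleph_le_mk_inter (hN : N ⊆ Below (ℵ_ ω)) (hcard : #N = ℵ_ ω) (n : ℕ) :
    ∃ m : ℕ, ℵ_ n ≤ #(N ∩ Iio (ℵ_ (m : Ordinal.{u})).ord : Set Ordinal.{u}) := by
  by_contra! hlt
  have hsub : N ⊆ ⋃ m : ULift.{u + 1} ℕ, N ∩ Iio (ℵ_ (m.down : Ordinal.{u})).ord := by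
    intro x hx
    obtain ⟨m, hm⟩ := exists_lt_ord_aleph_nat (hN hx)
    exact mem_iUnion.2 ⟨⟨m⟩, hx, hm⟩
  have hle : #N ≤ ℵ_ n := by
    refine (Cardinal.mk_le_mk_of_subset hsub).trans ((Cardinal.mk_iUnion_le _).trans ?_)
    have h1 : #(ULift.{u + 1} ℕ) ≤ ℵ_ (n : Ordinal.{u + 1}) := by
      simp
    refine Cardinal.mul_le_of_le (Cardinal.aleph0_le_aleph _) h1 ?_
    refine ciSup_le' ?_
    intro m
    exact (hlt m.down).le
  rw [hcard] at hle
  exact hle.not_gt (aleph_nat_lt_aleph_omega n)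

/-- If `|N ∩ ω_m| = ℵ_m` for all sufficiently large `m`, then `N` is all of `ω_ω`. -/
theorem OpClosed.eq_below (h : OpClosed baseOps N) (hN : N ⊆ Below (ℵ_ ω)) {k : ℕ}
    (hk : ∀ m > k, ℵ_ m ≤ #(N ∩ Iio (ℵ_ (m : Ordinal.{u})).ord : Set Ordinal.{u})) :
    N = Below (ℵ_ ω) := by
  have hall : ∀ m : ℕ, ℵ_ m ≤ #(N ∩ Iio (ℵ_ (m : Ordinal.{u})).ord : Set Ordinal.{u}) := by
    intro m
    by_contra! hm
    -- a deficiency `|N ∩ ω_m| < ℵ_m` persists at all later levels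
    have key : ∀ j : ℕ, #(N ∩ Iio (ℵ_ ((m + j : ℕ) : Ordinal.{u})).ord : Set Ordinal.{u}) <
        ℵ_ ((m + j : ℕ)) := by
      intro j
      induction j with
      | zero => exact hm
      | succ j ih =>
        by_contra! hge
        obtain ⟨α, hα, hα'⟩ : ∃ α ∈ N ∩ Iio (ℵ_ ((m + (j + 1) : ℕ) : Ordinal.{u})).ord,
            ℵ_ ((m + j : ℕ)) ≤ #(N ∩ Iio α : Set Ordinal.{u}) := by
          by_contra! hα
          have := typeLT_le_ord (N ∩ Iio (ℵ_ ((m + (j + 1) : ℕ) : Ordinal.{u})).ord)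
            (ℵ_ ((m + j : ℕ))) fun a ha => (Cardinal.mk_le_mk_of_subset
              (inter_subset_inter_left _ inter_subset_left)).trans_lt (hα a ha)
          have := Ordinal.card_le_card this
          rw [Ordinal.card_type, Cardinal.card_ord] at this
          exact absurd (hge.trans this) (not_le.2 (Cardinal.aleph_lt_aleph.2
            (by exact_mod_cast Nat.lt_succ_self _)))
        exact absurd (hα'.trans (h.mk_inter_Iio_le (m := m + j) hα.1 hα.2)) ih.not_ge
    have := key (k + 1)
    exact absurd (hk (m + (k + 1)) (by omega)) this.not_ge
  have hsub : ∀ m : ℕ, Iio (ℵ_ (m : Ordinal.{u})).ord ⊆ N := by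
    intro m
    induction m with
    | zero =>
      intro x hx
      have hx' : x < ω := by simpa using hx
      obtain ⟨n, rfl⟩ := Ordinal.lt_omega0.1 hx'
      exact h.natCast_mem n
    | succ m ih =>
      intro ξ hξ
      -- `N ∩ ω_{m+1}` is too large to be bounded by `ξ`
      obtain ⟨α, hα, hξα⟩ : ∃ α ∈ N ∩ Iio (ℵ_ ((m + 1 : ℕ) : Ordinal.{u})).ord, ξ < α := by
        by_contra! hle
        have h1 : #(N ∩ Iio (ℵ_ ((m + 1 : ℕ) : Ordinal.{u})).ord : Set Ordinal.{u}) ≤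
            #(Iio (Order.succ ξ)) :=
          Cardinal.mk_le_mk_of_subset fun α hα => Order.lt_succ_iff.2 (hle α hα)
        have h2 := (hall (m + 1)).trans h1
        have h3 : Order.succ ξ < (ℵ_ ((m + 1 : ℕ) : Ordinal.{u})).ord :=
          (Cardinal.isSuccLimit_ord (Cardinal.aleph0_le_aleph _)).succ_lt hξ
        rw [Cardinal.mk_Iio_ordinal] at h2
        rw [Cardinal.lt_ord] at h3
        have h4 := Cardinal.lift_lt.{u, u + 1}.2 h3
        rw [Cardinal.lift_aleph] at h4
        exact absurd h2 (by simpa using h4)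
      have hc := mapsTo_collapse α hξα
      have hle : α.card.ord ≤ (ℵ_ (m : Ordinal.{u})).ord := by
        have := Cardinal.lt_ord.1 hα.2
        rw [aleph_natCast_add_one, Order.lt_succ_iff] at this
        exact Cardinal.ord_le_ord.2 this
      rw [← uncollapse_collapse hξα]
      apply h.uncollapse_mem hα.1 (ih (hc.trans_le hle))
      rw [uncollapse_collapse hξα]
      exact lt_trans hξ (Cardinal.ord_lt_ord.2 (aleph_nat_lt_aleph_omega _))
  refine hN.antisymm fun x hx => ?_
  obtain ⟨m, hm⟩ := exists_lt_ord_aleph_nat hx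
  exact hsub m hm

/-- The characteristic function of a subset of `ω_ω` of full size closed under the basic
operations exists, is strictly increasing, and is the identity only for `ω_ω` itself. -/
theorem OpClosed.exists_chi (h : OpClosed baseOps N) (hN : N ⊆ Below (ℵ_ ω)) (hcard : #N = ℵ_ ω) :
    ∃ f : ℕ → ℕ, StrictMono f ∧ (f = id → N = Below (ℵ_ ω)) ∧
      ∀ n m : ℕ, (n ≤ m ∧
        typeLT (N ∩ Iio (ℵ_ (m : Ordinal.{u})).ord : Set Ordinal.{u}) = (ℵ_ n).ord) ↔ m = f n := by
  classical
  have hex := exists_aleph_le_mk_inter hN hcard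
  set f : ℕ → ℕ := fun n => Nat.find (hex n) with hf
  have htype : ∀ n, typeLT (N ∩ Iio (ℵ_ (f n : Ordinal.{u})).ord : Set Ordinal.{u}) =
      (ℵ_ n).ord := by
    intro n
    refine le_antisymm (h.typeLT_inter_Iio_le fun j hj => not_le.1 (Nat.find_min (hex n) hj)) ?_
    rw [Cardinal.ord_le, Ordinal.card_type]
    exact Nat.find_spec (hex n)
  have hmono : StrictMono f := by
    intro n n' hn
    rw [← h.typeLT_strictMono.lt_iff_lt]
    simp only [htype]
    exact Cardinal.ord_lt_ord.2 (Cardinal.aleph_lt_aleph.2 (by exact_mod_cast hn))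
  refine ⟨f, hmono, fun hid => h.eq_below hN (k := 0) fun m _ => ?_, fun n m => ⟨?_, ?_⟩⟩
  · have := Nat.find_spec (hex m)
    change ℵ_ m ≤ #(N ∩ Iio (ℵ_ (f m : Ordinal.{u})).ord : Set Ordinal.{u}) at this
    rwa [hid] at this
  · rintro ⟨-, hm⟩
    exact h.typeLT_strictMono.injective (hm.trans (htype n).symm)
  · rintro rfl
    exact ⟨hmono.le_apply, htype n⟩

end

/-! ### Adding small ordinals to a closed set -/

instance : Countable (Σ n, opLang.Functions n) :=
  inferInstanceAs (Countable (Σ _ : ℕ, ℕ))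

theorem iSup_lt_ord_aleph_succ {ι : Type u} {f : ι → Ordinal.{u}} {m : ℕ}
    (hι : #ι < ℵ_ ((m + 1 : ℕ) : Ordinal.{u}))
    (hf : ∀ i, f i < (ℵ_ ((m + 1 : ℕ) : Ordinal.{u})).ord) :
    ⨆ i, f i < (ℵ_ ((m + 1 : ℕ) : Ordinal.{u})).ord := by
  refine Ordinal.iSup_lt_of_lt_cof ?_ hf
  have hreg : (ℵ_ ((m + 1 : ℕ) : Ordinal.{u})).IsRegular := by
    rw [Nat.cast_add, Nat.cast_one]
    exact Cardinal.isRegular_aleph_add_one _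
  rwa [hreg.cof_ord]

/-- A set of fewer than `ℵ_{m+1}` ordinals below `ω_{m+1}` is bounded in `ω_{m+1}`. -/
theorem exists_bound_of_mk_lt {S : Set Ordinal.{u}} {m : ℕ}
    (hS : S ⊆ Iio (ℵ_ ((m + 1 : ℕ) : Ordinal.{u})).ord)
    (hcard : #S < ℵ_ ((m + 1 : ℕ) : Ordinal.{u + 1})) :
    ∃ δ < (ℵ_ ((m + 1 : ℕ) : Ordinal.{u})).ord, ∀ x ∈ S, x ≤ δ := by
  have : Small.{u} S := small_subset hS
  refine ⟨⨆ i : Shrink.{u} S, ((equivShrink S).symm i : Ordinal.{u}),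
    iSup_lt_ord_aleph_succ ?_ fun i => hS ((equivShrink S).symm i).2, fun x hx => ?_⟩
  · rw [← Cardinal.lift_lt.{u, u + 1}]
    refine lt_of_eq_of_lt ?_ (hcard.trans_eq ?_)
    · exact (Cardinal.lift_mk_eq'.2 ⟨(equivShrink.{u} S).symm⟩).trans
        (Cardinal.lift_id'.{u, u + 1} _)
    · simp
  · have := Ordinal.le_iSup (fun i : Shrink.{u} S => ((equivShrink S).symm i : Ordinal.{u}))
      (equivShrink S ⟨x, hx⟩)
    simpa using this

/-- The value of a term at the ordinals in the list `l`, for the variables marked by `D`, and at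
elements of the family `w`, indexed by `b`, for the other variables. -/
noncomputable def mixedVal (g : ℕ → List Ordinal.{u} → Ordinal.{u}) {J : Type u}
    (w : J → Below (ℵ_ ω : Cardinal.{u})) {r : ℕ} (t : opLang.Term (Fin r)) (D : Fin r → Bool)
    (l : List Ordinal.{u}) (b : Fin r → J) : Ordinal.{u} :=
  letI := opStructure g
  ((t.realize fun i => if D i then
    (if h : l.getD i 0 < (ℵ_ ω).ord then ⟨_, h⟩ else ⟨0, zero_lt_ord_aleph _⟩) else w (b i) :
      Below (ℵ_ ω : Cardinal.{u})) : Ordinal.{u})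

/-- The supremum of those values of a term that are below `ω_m`, over all choices of elements of
the family `w` for the variables that are not marked by `D`. -/
noncomputable def supOp (g : ℕ → List Ordinal.{u} → Ordinal.{u}) {J : Type u}
    (w : J → Below (ℵ_ ω : Cardinal.{u}))
    (p : (Σ r, opLang.Term (Fin r) × (Fin r → Bool)) × ℕ) (l : List Ordinal.{u}) : Ordinal.{u} :=
  ⨆ b : Fin p.1.1 → J,
    if mixedVal g w p.1.2.1 p.1.2.2 l b < (ℵ_ (p.2 : Ordinal.{u})).ord then
      mixedVal g w p.1.2.1 p.1.2.2 l b else 0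

/-- If `M` is closed under the supremum operations, then adjoining at most `ℵ_m` ordinals to `M` and
closing off does not raise the supremum of `M ∩ ω_{m+1}`: every element of the hull is the value of a term at
elements of `M` and new elements, hence below a supremum lying in `M`. -/
theorem exists_le_of_mem_closure (g : ℕ → List Ordinal.{u} → Ordinal.{u}) {J : Type u}
    [Nonempty J] (w : J → Below (ℵ_ ω : Cardinal.{u})) {M : Set Ordinal.{u}}
    (h0 : 0 ∈ M) (hsup : OpClosed (range (supOp g w)) M) {m : ℕ}
    (hJ : #J ≤ ℵ_ (m : Ordinal.{u})) :
    letI := opStructure g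
    ∀ x : Below (ℵ_ ω : Cardinal.{u}),
      x ∈ FirstOrder.Language.Substructure.closure opLang (Subtype.val ⁻¹' M ∪ range w) →
      (x : Ordinal.{u}) < (ℵ_ ((m + 1 : ℕ) : Ordinal.{u})).ord →
      ∃ y ∈ M, y < (ℵ_ ((m + 1 : ℕ) : Ordinal.{u})).ord ∧ x ≤ y := by
  classical
  let := opStructure g
  intro x hx hlt
  obtain ⟨t, rfl⟩ := FirstOrder.Language.Substructure.mem_closure_iff_exists_term.1 hx
  let r := t.varFinset.card
  let e : t.varFinset ≃ Fin r := t.varFinset.equivFin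
  let val : Fin r → Below (ℵ_ ω : Cardinal.{u}) := fun i => ((e.symm i).1).1
  -- `D` marks the variables with values in `M`; the other values belong to the family `w`
  let D : Fin r → Bool := fun i => decide ((val i : Ordinal.{u}) ∈ M)
  let l : List Ordinal.{u} := List.ofFn fun i => if (val i : Ordinal.{u}) ∈ M then (val i : Ordinal.{u}) else 0
  have hb : ∀ i, ∃ j : J, (val i : Ordinal.{u}) ∉ M → w j = val i := by
    intro i
    rcases ((e.symm i).1).2 with hi | ⟨j, hj⟩
    · exact ⟨Classical.arbitrary J, fun h => absurd hi h⟩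
    · exact ⟨j, fun _ => hj⟩
  choose b hb using hb
  have hval : mixedVal g w (t.restrictVar e) D l b = t.realize Subtype.val := by
    unfold mixedVal
    congr 1
    refine FirstOrder.Language.Term.realize_restrictVar _ fun a => ?_
    have hlget : l.getD (e a) 0 =
        if (val (e a) : Ordinal.{u}) ∈ M then (val (e a) : Ordinal.{u}) else 0 := by
      simp [l]
    have hva : val (e a) = a.1.1 := by simp [val]
    rw [← hva]
    by_cases ha : (val (e a) : Ordinal.{u}) ∈ M
    · have hD : D (e a) = true := by simp [D, ha]
      rw [if_pos ha] at hlget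
      rw [if_pos hD, dif_pos (hlget.trans_lt (val (e a)).2)]
      exact Subtype.ext hlget
    · have hD : ¬ D (e a) = true := by simp [D, ha]
      rw [if_neg hD]
      exact hb _ ha
  let p : (Σ r, opLang.Term (Fin r) × (Fin r → Bool)) × ℕ := (⟨r, t.restrictVar e, D⟩, m + 1)
  have hplt : supOp g w p l < (ℵ_ ((m + 1 : ℕ) : Ordinal.{u})).ord := by
    refine iSup_lt_ord_aleph_succ ?_ fun b => ?_
    · have h1 : #(Fin p.1.1 → J) ≤ ℵ_ (m : Ordinal.{u}) := by
        have : #(Fin p.1.1 → J) = #J ^ p.1.1 := by simp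
        rw [this]
        exact (pow_le_pow_left' hJ _).trans (Cardinal.power_nat_le (Cardinal.aleph0_le_aleph _))
      refine h1.trans_lt (Cardinal.aleph_lt_aleph.2 (by exact_mod_cast Nat.lt_succ_self m))
    · split_ifs with h
      · exact h
      · exact zero_lt_ord_aleph _
  refine ⟨supOp g w p l, hsup _ ⟨p, rfl⟩ l ?_
    (hplt.trans (Cardinal.ord_lt_ord.2 (aleph_nat_lt_aleph_omega _))), hplt, ?_⟩
  · intro y hy
    obtain ⟨i, rfl⟩ := (List.mem_ofFn' _ _).1 hy
    dsimp only
    split_ifs with h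
    · exact h
    · exact h0
  · have := Ordinal.le_iSup (fun b : Fin p.1.1 → J =>
      if mixedVal g w p.1.2.1 p.1.2.2 l b < (ℵ_ (p.2 : Ordinal.{u})).ord then
      mixedVal g w p.1.2.1 p.1.2.2 l b else 0) b
    dsimp only [p] at this
    rw [hval, if_pos hlt] at this
    exact this

/-- If `ℵ_ω` is Jónsson, then countably many operations on `ω_ω` have a common proper closed set of
full size containing any prescribed `ω_k`. -/
theorem IsJonsson.exists_opClosed_Iio_subset (hJ : IsJonsson (ℵ_ ω : Cardinal.{u}))
    {G : Set (List Ordinal.{u} → Ordinal.{u})} (hG : G.Countable) (hbase : baseOps ⊆ G) (k : ℕ) :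
    ∃ N ⊆ Below (ℵ_ ω : Cardinal.{u}), OpClosed G N ∧ Iio (ℵ_ (k : Ordinal.{u})).ord ⊆ N ∧
      #N = ℵ_ ω ∧ N ≠ Below (ℵ_ ω) := by
  have hne : G.Nonempty := ⟨_, hbase (Or.inl (Or.inl ⟨0, rfl⟩))⟩
  obtain ⟨g, hg⟩ := hG.exists_eq_range hne
  let J : Type u := (ℵ_ (k : Ordinal.{u})).ord.ToType
  have hJk : #J = ℵ_ (k : Ordinal.{u}) := by simp [J]
  have hJne : Nonempty J := Cardinal.mk_ne_zero_iff.1 (hJk ▸ (Cardinal.aleph_pos _).ne')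
  have hklt : (ℵ_ (k : Ordinal.{u})).ord < (ℵ_ ω).ord :=
    Cardinal.ord_lt_ord.2 (aleph_nat_lt_aleph_omega k)
  let w : J → Below (ℵ_ ω : Cardinal.{u}) := fun j =>
    ⟨(Ordinal.ToType.mk.symm j : Iio (ℵ_ (k : Ordinal.{u})).ord),
      mem_Iio.2 (lt_trans (Ordinal.ToType.mk.symm j).2 hklt)⟩
  obtain ⟨M, hM, hMcl, hMcard, hMne⟩ := hJ.exists_opClosed
    (hG.union (countable_range (supOp g w))) (hne.mono subset_union_left)
  have hMG : OpClosed G M := hMcl.mono subset_union_left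
  have hMb : OpClosed baseOps M := hMG.mono hbase
  obtain ⟨m, hkm, hm⟩ : ∃ m > k,
      #(M ∩ Iio (ℵ_ (m : Ordinal.{u})).ord : Set Ordinal.{u}) < ℵ_ m := by
    by_contra! h
    exact hMne (hMb.eq_below hM h)
  obtain ⟨m, rfl⟩ : ∃ m', m = m' + 1 := ⟨m - 1, by omega⟩
  obtain ⟨δ, hδ, hδM⟩ := exists_bound_of_mk_lt inter_subset_right hm
  let := opStructure g
  let S := FirstOrder.Language.Substructure.closure opLang (Subtype.val ⁻¹' M ∪ range w)
  have hMS : M ⊆ Subtype.val '' (S : Set (Below (ℵ_ ω : Cardinal.{u}))) := fun x hx =>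
    ⟨⟨x, hM hx⟩, FirstOrder.Language.Substructure.subset_closure (Or.inl hx), rfl⟩
  have hSsub : Subtype.val '' (S : Set (Below (ℵ_ ω : Cardinal.{u}))) ⊆ Below (ℵ_ ω) := by
    rintro _ ⟨x, -, rfl⟩
    exact x.2
  refine ⟨Subtype.val '' (S : Set (Below (ℵ_ ω : Cardinal.{u}))), hSsub, ?_, fun x hx => ?_, ?_, ?_⟩
  · rw [hg]
    exact opClosed_of_substructure g S
  · refine ⟨⟨x, lt_trans hx hklt⟩,
      FirstOrder.Language.Substructure.subset_closure (Or.inr ⟨Ordinal.ToType.mk ⟨x, hx⟩, ?_⟩), rfl⟩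
    simp [w]
  · refine le_antisymm ((Cardinal.mk_le_mk_of_subset hSsub).trans ?_)
      (hMcard ▸ Cardinal.mk_le_mk_of_subset hMS)
    simp [Cardinal.mk_Iio_ordinal]
  · intro heq
    -- an element of the hull between `δ` and `ω_{m+1}` would be bounded by an element of `M`
    have hs : Order.succ δ < (ℵ_ ((m + 1 : ℕ) : Ordinal.{u})).ord :=
      (Cardinal.isSuccLimit_ord (Cardinal.aleph0_le_aleph _)).succ_lt hδ
    obtain ⟨x, hx, hxδ⟩ := heq.symm.subset
      (hs.trans (Cardinal.ord_lt_ord.2 (aleph_nat_lt_aleph_omega (m + 1))))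
    obtain ⟨y, hy, hylt, hxy⟩ := exists_le_of_mem_closure g w
      (by simpa using hMb.natCast_mem 0) (hMcl.mono subset_union_right) (m := m)
      (hJk.trans_le (Cardinal.aleph_le_aleph.2 (by exact_mod_cast Nat.lt_succ_iff.1 hkm))) x hx
      (hxδ ▸ hs)
    rw [hxδ] at hxy
    exact absurd ((Order.lt_succ δ).trans_le (hxy.trans (hδM y ⟨hy, hylt⟩))) (lt_irrefl _)

/-! ### Transfer to `H_{ℵ_ω}` -/

theorem toZFSet_mem_H {θ : Cardinal.{u}} {α : Ordinal.{u}} (h : α < θ.ord) : α.toZFSet ∈ H θ := by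
  have hsub : trcl α.toZFSet ⊆ Ordinal.toZFSet '' Iio α := by
    intro z hz
    induction hz using Relation.TransGen.head_induction_on with
    | single hz =>
      obtain ⟨β, hβ, rfl⟩ := Ordinal.mem_toZFSet_iff.1 hz
      exact ⟨β, hβ, rfl⟩
    | head hz _ ih =>
      obtain ⟨β, hβ, rfl⟩ := ih
      obtain ⟨γ, hγ, rfl⟩ := Ordinal.mem_toZFSet_iff.1 hz
      exact ⟨γ, lt_trans hγ hβ, rfl⟩
  refine (Cardinal.mk_le_mk_of_subset hsub).trans_lt (Cardinal.mk_image_le.trans_lt ?_)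
  rw [Cardinal.mk_Iio_ordinal, Cardinal.lift_lt]
  exact Cardinal.lt_ord.1 h

/-- The von Neumann ordinal of `α` as an element of `H_{ℵ_ω}` (the empty set if `α` is not below
`ω_ω`). -/
noncomputable def ordH (α : Ordinal.{u}) : H (ℵ_ ω : Cardinal.{u}) :=
  if h : α < (ℵ_ ω).ord then ⟨α.toZFSet, toZFSet_mem_H h⟩
  else ⟨Ordinal.toZFSet 0, toZFSet_mem_H (zero_lt_ord_aleph _)⟩

theorem coe_ordH {α : Ordinal.{u}} (h : α < (ℵ_ ω).ord) : (ordH α : ZFSet.{u}) = α.toZFSet := by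
  rw [ordH, dif_pos h]

theorem injOn_ordH : InjOn ordH (Below (ℵ_ ω : Cardinal.{u})) := fun α hα β hβ h =>
  Ordinal.toZFSet_injective (by rw [← coe_ordH hα, ← coe_ordH hβ, h])

instance : Nonempty (H (ℵ_ ω : Cardinal.{u})) := ⟨ordH 0⟩

/-- The language of set theory with Skolem functions. -/
abbrev skolemLang : FirstOrder.Language.{0, 0} := setLang.sum setLang.skolem₁

instance : Countable setLang.Symbols := by
  have : ∀ n, Countable (SetRel n) := fun n =>
    ⟨⟨fun _ => 0, fun a b _ => by cases a; cases b; rfl⟩⟩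
  exact inferInstanceAs (Countable ((Σ _ : ℕ, Empty) ⊕ (Σ n : ℕ, SetRel n)))

instance : Countable (Σ n, skolemLang.Functions n) := by
  rw [← Cardinal.mk_le_aleph0_iff]
  refine FirstOrder.Language.card_functions_sum_skolem₁_le.trans ?_
  rw [max_eq_left]
  exact Cardinal.mk_le_aleph0_iff.2 inferInstance

/-- The language with a function symbol of each arity for each `f : ℕ → ℕ`. -/
def famLang : FirstOrder.Language.{0, 0} where
  Functions := fun _ => ℕ → ℕ
  Relations := fun _ => Empty

/-- A family of functions on finite sets, indexed by the functions `ℕ → ℕ`, as a structure. -/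
@[reducible] noncomputable def famStructure {A : Type*} (F : (ℕ → ℕ) → Finset A → A) :
    famLang.Structure A where
  funMap := fun {_} φ v => F φ (finite_range v).toFinset
  RelMap := fun r => r.elim

theorem mk_functions_le : #(Σ n, (skolemLang.sum famLang).Functions n) ≤ 𝔠 := by
  rw [Cardinal.mk_sigma]
  refine (Cardinal.sum_le_mk_mul_iSup _).trans ?_
  refine Cardinal.mul_le_of_le Cardinal.aleph0_le_continuum (by simp [Cardinal.aleph0_le_continuum])
    (ciSup_le' fun n => ?_)
  rw [FirstOrder.Language.card_functions_sum]
  have h1 : #(skolemLang.Functions n) ≤ ℵ₀ := by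
    have : Countable (skolemLang.Functions n) :=
      Function.Injective.countable (f := fun s => (⟨n, s⟩ : Σ n, skolemLang.Functions n))
        fun a b h => by simpa using h
    exact Cardinal.mk_le_aleph0_iff.2 this
  have h2 : #(famLang.Functions n) = 𝔠 := by
    change #(ℕ → ℕ) = 𝔠
    simp
  rw [h2]
  simpa using Cardinal.add_le_of_le Cardinal.aleph0_le_continuum
    (h1.trans Cardinal.aleph0_le_continuum) le_rfl

/-- Every family of functions on finite sets has a set of size `ℵ_ω` that contains all ordinals below
`ω_ω` and is closed under the family and under Skolem functions. -/
theorem exists_hull (hc : (2 : Cardinal.{u}) ^ (ℵ₀ : Cardinal.{u}) < ℵ_ ω)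
    (F : (ℕ → ℕ) → Finset (H (ℵ_ ω : Cardinal.{u})) → H (ℵ_ ω : Cardinal.{u})) :
    ∃ K : Set (H (ℵ_ ω : Cardinal.{u})), #K = ℵ_ ω ∧ (∀ α, ordH α ∈ K) ∧
      (∀ φ, ClosedUnder (F φ) K) ∧
      ∀ n (ψ : skolemLang.Functions n) (v : Fin n → H (ℵ_ ω : Cardinal.{u})), (∀ i, v i ∈ K) →
        FirstOrder.Language.Structure.funMap ψ v ∈ K := by
  classical
  let := famStructure F
  let S := FirstOrder.Language.Substructure.closure (skolemLang.sum famLang)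
    (range (ordH : Ordinal.{u} → _))
  have hord : ∀ α, ordH α ∈ S := fun α =>
    FirstOrder.Language.Substructure.subset_closure ⟨α, rfl⟩
  have hbelow : #(Below (ℵ_ ω : Cardinal.{u})) = ℵ_ ω := by
    simp [Cardinal.mk_Iio_ordinal]
  refine ⟨S, le_antisymm ?_ ?_, hord, ?_, ?_⟩
  · have h := FirstOrder.Language.Substructure.lift_card_closure_le
      (L := skolemLang.sum famLang) (s := range (ordH : Ordinal.{u} → _))
    have hr : #(range (ordH : Ordinal.{u} → _)) ≤ ℵ_ ω := by
      rw [← hbelow]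
      have : range (ordH : Ordinal.{u} → _) ⊆ ordH '' Below (ℵ_ ω : Cardinal.{u}) := by
        rintro _ ⟨α, rfl⟩
        by_cases hα : α < (ℵ_ ω).ord
        · exact ⟨α, hα, rfl⟩
        · refine ⟨0, zero_lt_ord_aleph _, ?_⟩
          rw [ordH, ordH, dif_neg hα, dif_pos (zero_lt_ord_aleph _)]
      exact (Cardinal.mk_le_mk_of_subset this).trans Cardinal.mk_image_le
    have hf : Cardinal.lift.{u + 1} #(Σ n, (skolemLang.sum famLang).Functions n) ≤ ℵ_ ω := by
      refine (Cardinal.lift_le.2 mk_functions_le).trans ?_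
      have := Cardinal.lift_le.{u + 1}.2 hc.le
      simpa using this
    have h' : #S ≤ max ℵ₀ (#(range (ordH : Ordinal.{u} → _)) +
        Cardinal.lift.{u + 1} #(Σ n, (skolemLang.sum famLang).Functions n)) := by
      simpa using h
    exact h'.trans (max_le (Cardinal.aleph0_le_aleph _)
      (Cardinal.add_le_of_le (Cardinal.aleph0_le_aleph _) hr hf))
  · rw [← hbelow, ← Cardinal.mk_image_eq_of_injOn _ _ injOn_ordH]
    exact Cardinal.mk_le_mk_of_subset (by rintro _ ⟨α, -, rfl⟩; exact hord α)
  · intro φ s hs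
    have := S.fun_mem (n := s.card) (Sum.inr φ) (fun i => (s.equivFin.symm i : H _))
      fun i => hs (s.equivFin.symm i).2
    change F φ (finite_range _).toFinset ∈ S at this
    have hs' : (finite_range fun i => (s.equivFin.symm i : H (ℵ_ ω : Cardinal.{u}))).toFinset = s := by
      ext x
      simp only [Finite.mem_toFinset, mem_range]
      constructor
      · rintro ⟨i, rfl⟩
        exact (s.equivFin.symm i).2
      · intro hx
        exact ⟨s.equivFin ⟨x, hx⟩, by simp⟩
    rwa [hs'] at this
  · intro n ψ v hv
    exact S.fun_mem (Sum.inl ψ) v hv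

theorem exists_decoding {κ : Cardinal.{u}} (h : (2 : Cardinal.{u}) ^ (ℵ₀ : Cardinal.{u}) ≤ κ) :
    ∃ dec : Ordinal.{u} → ℕ → ℕ, ∀ φ, ∃ α < κ.ord, dec α = φ := by
  have hle : Cardinal.lift.{u + 1} #(ℕ → ℕ) ≤ Cardinal.lift.{0} #(Iio κ.ord) := by
    have := Cardinal.lift_le.{u + 1}.2 h
    simpa [Cardinal.mk_Iio_ordinal] using this
  obtain ⟨i⟩ := Cardinal.lift_mk_le'.1 hle
  exact ⟨Function.invFun fun φ => (i φ : Ordinal.{u}), fun φ => ⟨i φ, (i φ).2,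
    Function.leftInverse_invFun (fun a b hab => i.injective (Subtype.ext hab)) φ⟩⟩

theorem typeLT_congr {S T : Set Ordinal.{u}} (h : S = T) : typeLT S = typeLT T := by
  subst h
  rfl

/-- The main step: every family of functions indexed by `ℕ → ℕ` has a common closed elementary
submodel whose characteristic function is defined and differs from the identity. The submodel
contains `2^ℵ₀` many ordinals, so that it is closed under the whole family at once. -/
theorem IsJonsson.exists_elementary (hJ : IsJonsson (ℵ_ ω : Cardinal.{u}))
    (hc : (2 : Cardinal.{u}) ^ (ℵ₀ : Cardinal.{u}) < ℵ_ ω)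
    (F : (ℕ → ℕ) → Finset (H (ℵ_ ω : Cardinal.{u})) → H (ℵ_ ω : Cardinal.{u})) :
    ∃ M : Set (H (ℵ_ ω : Cardinal.{u})), IsElementary M ∧ #M = ℵ_ ω ∧ (∀ φ, ClosedUnder (F φ) M) ∧
      ∃ f : ℕ → ℕ, StrictMono f ∧ f ≠ id ∧ ChiEq M f := by
  classical
  obtain ⟨K, hKcard, hKord, hKF, hKfun⟩ := exists_hull hc F
  obtain ⟨k, hk⟩ := exists_lt_aleph_nat hc
  obtain ⟨dec, hdec⟩ := exists_decoding hk.le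
  have hbelow : #(Below (ℵ_ ω : Cardinal.{u})) = #K := by
    simp [hKcard, Cardinal.mk_Iio_ordinal]
  obtain ⟨e⟩ := Cardinal.eq.1 hbelow
  -- `p` and `q` are mutually inverse bijections between `ω_ω` and `K`
  obtain ⟨p, q, hpK, hq, hpq, hqp⟩ : ∃ (p : Ordinal.{u} → H (ℵ_ ω : Cardinal.{u}))
      (q : H (ℵ_ ω : Cardinal.{u}) → Ordinal.{u}), (∀ ξ, p ξ ∈ K) ∧ (∀ x, q x < (ℵ_ ω).ord) ∧
      (∀ x ∈ K, p (q x) = x) ∧ ∀ ξ < (ℵ_ ω).ord, q (p ξ) = ξ := by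
    refine ⟨fun ξ => if h : ξ < (ℵ_ ω).ord then e ⟨ξ, h⟩ else ordH 0,
      fun x => if h : x ∈ K then e.symm ⟨x, h⟩ else 0, fun ξ => ?_, fun x => ?_, fun x hx => ?_,
      fun ξ hξ => ?_⟩
    · dsimp only
      split_ifs with h
      · exact (e ⟨ξ, h⟩).2
      · exact hKord 0
    · dsimp only
      split_ifs with h
      · exact (e.symm ⟨x, h⟩).2
      · exact zero_lt_ord_aleph _
    · have : (e.symm ⟨x, hx⟩ : Ordinal.{u}) < (ℵ_ ω).ord := (e.symm ⟨x, hx⟩).2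
      simp only [hx, dite_true, dif_pos this, Subtype.coe_eta, Equiv.apply_symm_apply]
    · have : ((e ⟨ξ, hξ⟩ : K) : H _) ∈ K := (e ⟨ξ, hξ⟩).2
      simp only [hξ, dite_true, dif_pos this, Subtype.coe_eta, Equiv.symm_apply_apply]
  -- the operations on `ω_ω` corresponding to the Skolem functions, to the whole family `F` with the
  -- index coded by the first argument, and to the inclusion of the ordinals and its inverse
  let skolemOp : (Σ n, skolemLang.Functions n) → List Ordinal.{u} → Ordinal.{u} := fun ψ l =>
    q (FirstOrder.Language.Structure.funMap ψ.2 fun i => p (l.getD i 0))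
  let famOp : List Ordinal.{u} → Ordinal.{u} := fun l =>
    q (F (dec (l.headD 0)) (l.tail.map p).toFinset)
  let ordOp : List Ordinal.{u} → Ordinal.{u} := fun l => q (ordH (l.getD 0 0))
  let rankOp : List Ordinal.{u} → Ordinal.{u} := fun l => (p (l.getD 0 0) : ZFSet.{u}).rank
  obtain ⟨N, hN, hNcl, hkN, hNcard, hNne⟩ := hJ.exists_opClosed_Iio_subset
    (G := baseOps ∪ (range skolemOp ∪ {famOp, ordOp, rankOp}))
    (countable_baseOps.union ((countable_range _).union (by simp))) subset_union_left k
  have hNb : OpClosed baseOps N := hNcl.mono subset_union_left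
  obtain ⟨f, hf, hfid, hchi⟩ := hNb.exists_chi hN hNcard
  have hinter : ∀ κ : Cardinal.{u}, κ ≤ ℵ_ ω → inter (p '' N) κ = N ∩ Iio κ.ord := by
    intro κ hκ
    ext α
    constructor
    · rintro ⟨hα, _, ⟨ξ, hξ, rfl⟩, hx⟩
      have hr : rankOp [ξ] = α := by
        change (p ξ : ZFSet.{u}).rank = α
        rw [hx, Ordinal.rank_toZFSet]
      refine ⟨?_, hα⟩
      rw [← hr]
      refine hNcl rankOp (by simp) [ξ] (by simpa using hξ) ?_
      rw [hr]
      exact hα.trans_le (Cardinal.ord_le_ord.2 hκ)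
    · rintro ⟨hαN, hα⟩
      refine ⟨hα, ordH α, ⟨q (ordH α), ?_, hpq _ (hKord α)⟩, coe_ordH (hN hαN)⟩
      exact hNcl ordOp (by simp) [α] (by simpa using hαN) (hq _)
  have hinj : InjOn p N := fun ξ hξ ζ hζ h => by
    rw [← hqp ξ (hN hξ), ← hqp ζ (hN hζ), h]
  refine ⟨p '' N, ?_, ?_, ?_, f, hf, fun h => hNne (hfid h), ?_, ?_⟩
  · let S : skolemLang.Substructure (H (ℵ_ ω : Cardinal.{u})) :=
      { carrier := p '' N
        fun_mem := by
          intro n ψ v hv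
          choose ξ hξ hξv using hv
          have hmem : skolemOp ⟨n, ψ⟩ (List.ofFn ξ) ∈ N := by
            refine hNcl _ (Or.inr (Or.inl ⟨_, rfl⟩)) _ ?_ (hq _)
            intro x hx
            obtain ⟨i, rfl⟩ := (List.mem_ofFn' _ _).1 hx
            exact hξ i
          refine ⟨_, hmem, ?_⟩
          have hv : (fun i : Fin n => p ((List.ofFn ξ).getD i 0)) = v := by
            funext i
            rw [← hξv i]
            simp
          change p (q (FirstOrder.Language.Structure.funMap ψ
            fun i : Fin n => p ((List.ofFn ξ).getD i 0))) = _
          rw [hv]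
          exact hpq _ (hKfun n ψ v fun i => hξv i ▸ hpK _) }
    exact ⟨S.elementarySkolem₁Reduct, rfl⟩
  · rw [Cardinal.mk_image_eq_of_injOn _ _ hinj, hNcard]
  · intro φ s hs
    obtain ⟨α, hα, rfl⟩ := hdec φ
    choose! r hrN hr using hs
    have hmem : famOp (α :: s.toList.map r) ∈ N := by
      refine hNcl famOp (by simp) _ ?_ (hq _)
      intro x hx
      rcases List.mem_cons.1 hx with rfl | hx
      · exact hkN hα
      · obtain ⟨y, hy, rfl⟩ := List.mem_map.1 hx
        exact hrN (Finset.mem_toList.1 hy)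
    refine ⟨_, hmem, ?_⟩
    have hs' : ((s.toList.map r).map p).toFinset = s := by
      ext x
      simp only [List.mem_toFinset, List.mem_map, Finset.mem_toList, exists_exists_and_eq_and]
      constructor
      · rintro ⟨y, hy, rfl⟩
        rwa [hr hy]
      · intro hx
        exact ⟨x, hx, hr hx⟩
    change p (q (F (dec α) ((s.toList.map r).map p).toFinset)) = _
    rw [hs']
    exact hpq _ (hKF _ s fun x hx => hr hx ▸ hpK _)
  · rw [hinter _ le_rfl, inter_eq_left.2 hN, hNcard]
  · intro n m
    rw [typeLT_congr (hinter _ (aleph_nat_lt_aleph_omega m).le)]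
    exact hchi n m

/-! ### Generalized Chang's Conjecture -/

/-- The traces on `ω_ω` of the closed submodels with characteristic function `f` show that
`⟨ℵ_{f n}⟩ ↠ ⟨ℵ_n⟩`, stated here with the supremum of the `ℵ_{f n}` replaced by `ℵ_ω`. -/
theorem FJonsson.exists_closedUnder {f : ℕ → ℕ} (h : FJonsson.{u} f)
    (F : Finset (Below (ℵ_ ω : Cardinal.{u})) → Below (ℵ_ ω : Cardinal.{u})) :
    ∃ X : Set (Below (ℵ_ ω : Cardinal.{u})), ClosedUnder F X ∧ ∀ n : ℕ,
      #{α : Below (ℵ_ ω : Cardinal.{u}) | α ∈ X ∧ α.1 < (ℵ_ (f n : Ordinal.{u})).ord} =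
        ℵ_ (n : Ordinal.{u + 1}) := by
  classical
  let o : Below (ℵ_ ω : Cardinal.{u}) → H (ℵ_ ω : Cardinal.{u}) := fun α => ordH α
  have ho : Function.Injective o := fun α β hαβ => Subtype.ext (injOn_ordH α.2 β.2 hαβ)
  obtain ⟨M, ⟨-, -, hM⟩, hMF⟩ := h fun s => o (F (s.preimage o ho.injOn))
  refine ⟨o ⁻¹' M, fun s hs => ?_, fun n => ?_⟩
  · have := hMF (s.image o) fun x hx => by
      obtain ⟨α, hα, rfl⟩ := Finset.mem_image.1 hx
      exact hs hα
    have hs' : (s.image o).preimage o ho.injOn = s := by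
      ext α
      simp [ho.eq_iff]
    simp only [hs'] at this
    exact this
  · have htype := (((hM.2 n (f n)).2 rfl)).2
    have hcard := congrArg Ordinal.card htype
    rw [Ordinal.card_type, Cardinal.card_ord] at hcard
    rw [← hcard]
    refine Cardinal.mk_congr (Equiv.ofBijective (fun α => ⟨α.1.1, α.2.2, o α.1, α.2.1,
      coe_ordH α.1.2⟩) ⟨fun α β hαβ => ?_, ?_⟩)
    · simpa [Subtype.ext_iff] using hαβ
    rintro ⟨α, hα, x, hx, hxα⟩
    have hα' : α < (ℵ_ ω).ord := hα.trans (Cardinal.ord_lt_ord.2 (aleph_nat_lt_aleph_omega _))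
    have : o ⟨α, hα'⟩ = x := Subtype.ext ((coe_ordH hα').trans hxα.symm)
    exact ⟨⟨⟨α, hα'⟩, mem_preimage.2 (this.symm ▸ hx), hα⟩, rfl⟩

/-- Chang's Conjecture along the iterates `n_{i+1} = f(n_i)`, starting from any `n₀` moved
by `f`. -/
theorem FJonsson.exists_chang {f : ℕ → ℕ} (hf : StrictMono f) (hid : f ≠ id)
    (h : FJonsson.{u} f) :
    ∃ n : ℕ → ℕ, StrictMono n ∧
      Chang (fun i : ℕ => (ℵ_ (n (i + 1) : Ordinal.{u}) : Cardinal.{u}))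
        (fun i : ℕ => (ℵ_ (n i : Ordinal.{u}) : Cardinal.{u})) := by
  obtain ⟨n₀, hn₀⟩ : ∃ n₀, n₀ < f n₀ := by
    by_contra! hle
    exact hid (funext fun n => (hle n).antisymm hf.le_apply)
  have hn : StrictMono fun i => f^[i] n₀ := by
    refine strictMono_nat_of_lt_succ fun i => ?_
    rw [Function.iterate_succ_apply]
    exact hf.iterate i hn₀
  refine ⟨fun i => f^[i] n₀, hn, ?_⟩
  have hsup : ⨆ i : ℕ, (ℵ_ ((f^[i + 1] n₀ : ℕ) : Ordinal.{u}) : Cardinal.{u}) = ℵ_ ω := by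
    refine le_antisymm (ciSup_le' fun i => (aleph_nat_lt_aleph_omega _).le) ?_
    refine le_of_forall_lt fun c hc => ?_
    obtain ⟨m, hm⟩ := exists_lt_aleph_nat hc
    refine hm.trans_le (le_trans ?_ (le_ciSup (Cardinal.bddAbove_of_small) m))
    exact Cardinal.aleph_le_aleph.2 (by exact_mod_cast (Nat.le_succ m).trans hn.le_apply)
  unfold Chang
  beta_reduce
  rw [hsup]
  intro F
  obtain ⟨X, hXF, hX⟩ := h.exists_closedUnder F
  refine ⟨X, hXF, fun i => ?_⟩
  rw [Function.iterate_succ_apply']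
  simpa using hX (f^[i] n₀)

end Silver

theorem mainTheorem1
    (hJ : Silver.IsJonsson (ℵ_ ω : Cardinal.{u}))
    (hc : (2 : Cardinal.{u}) ^ (ℵ₀ : Cardinal.{u}) < ℵ_ ω) :
    (∃ f : ℕ → ℕ, StrictMono f ∧ f ≠ id ∧ Silver.FJonsson.{u} f) ∧
    (∃ n : ℕ → ℕ, StrictMono n ∧
      Silver.Chang (fun i : ℕ => (ℵ_ (n (i + 1) : Ordinal.{u}) : Cardinal.{u}))
        (fun i : ℕ => (ℵ_ (n i : Ordinal.{u}) : Cardinal.{u}))) := by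
  have hex : ∃ f : ℕ → ℕ, StrictMono f ∧ f ≠ id ∧ Silver.FJonsson.{u} f := by
    by_contra! hno
    simp only [Silver.FJonsson, Silver.Stationary, not_forall, not_exists, not_and] at hno
    choose! F hF using hno
    obtain ⟨M, hM, hMcard, hMF, f, hf, hfid, hchi⟩ := hJ.exists_elementary hc F
    exact hF f hf hfid M ⟨hM, hMcard, hchi⟩ (hMF f)
  obtain ⟨f, hf, hfid, hJf⟩ := hex
  exact ⟨⟨f, hf, hfid, hJf⟩, hJf.exists_chang hf hfid⟩
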